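/- Let $n\ge 1$ and $m\ge n+1$ be integers. There is a constant $C=C(n,m)>0$ such that the following holds. Let $I\subset\mathbb{R}$ be a compact interval, let $A\subset I$ be a finite non-empty set, and let $f$ be a polynomial with real coefficients of degree $m$. Then $$|2^n f(A-A)-(2^n-1)f(A-A)|\ \ge\ C\,|A|^{1+\phi(n)}.$$ Here $A-A=\{a-a' : a,a'\in A\}$ and $f(A-A)=\{f(x):x\in A-A\}$; for finite $S\subset\mathbb{R}$ and an integer $s\ge1$, $sS=\{x_1+\dots+x_s : x_1,\dots,x_s\in S\}$ is the $s$-fold sumset; for finite $X,Y\subset\mathbb{R}$, $X-Y=\{x-y: x\in X,\ y\in Y\}$; and $\phi$ is the sequence defined by $\phi(1)=1$ and $\phi(n)=1+\dfrac{1}{1+1/\phi(n-1)}$ for $n\ge 2$. -/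

import Mathlib

open scoped Pointwise Polynomial

/-- The exponent sequence `φ : {1, 2, 3, …} → ℝ`: `φ(1) = 1` and
`φ(n) = 1 + 1 / (1 + 1 / φ(n - 1))` for `n ≥ 2`. The value at `0` is a placeholder that is
never used. -/
noncomputable def phi : ℕ → ℝ
  | 0 => 0
  | 1 => 1
  | n + 2 => 1 + 1 / (1 + 1 / phi (n + 1))

/-- The `s`-fold sumset `sS = {x₁ + ⋯ + x_s : x₁, …, x_s ∈ S}` (not the dilate of `S` by `s`). -/
noncomputable def iterSum (s : ℕ) (S : Finset ℝ) : Finset ℝ :=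
  (Fintype.piFinset (fun _ : Fin s => S)).image (fun x => ∑ i, x i)

theorem mem_iterSum {s : ℕ} {S : Finset ℝ} {y : ℝ} :
    y ∈ iterSum s S ↔ ∃ x : Fin s → ℝ, (∀ i, x i ∈ S) ∧ ∑ i, x i = y := by
  simp [iterSum]

/-- The image `f(A - A)` of the difference set `A - A = {x - y : x, y ∈ A}`. -/
noncomputable def polyDiffImage (f : ℝ[X]) (A : Finset ℝ) : Finset ℝ :=
  (A - A).image (fun x => f.eval x)

theorem mem_polyDiffImage {f : ℝ[X]} {A : Finset ℝ} {z : ℝ} :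
    z ∈ polyDiffImage f A ↔ ∃ x ∈ A, ∃ y ∈ A, f.eval (x - y) = z := by
  simp only [polyDiffImage, Finset.mem_image, Finset.mem_sub]
  constructor
  · rintro ⟨_, ⟨x, hx, y, hy, rfl⟩, rfl⟩
    exact ⟨x, hx, y, hy, rfl⟩
  · rintro ⟨x, hx, y, hy, rfl⟩
    exact ⟨_, ⟨x, hx, y, hy, rfl⟩, rfl⟩

/-! Since `phi n ≤ 2`, it suffices to prove exponent 2 for 2S - S when n = 1 and exponent 3 for 4S -
3S when n ≥ 2, with S = f(A - A). Adding a fixed multiple of an element of S to both sides carries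
4S - 3S into the larger sumsets.

Median splittings give large subsets of A on whose differences f and f' are monotone
(`exists_grid`). So e i j = f(a_i - b_j) increases in i, and its i-gaps e (i+1) j - e i j are
positive and decrease in j. Fix a row z whose gap at j = 0 is at most the median. Its p gaps all fit
inside at least half of the intervals (e i 0, e (i+1) 0], giving about p^2 / 2 distinct sums in 2S -
S.

For the cube, the gaps of row z are themselves used as a sequence. If their consecutive differences
take T values, subtracting smaller differences from the gaps yields T^2 / 2 short lengths instead of
p. Rolle's theorem bounds coincidences among these differences on average over rows, so some row has
T at least of order p / m. -/

/-! ### Medians and one-sided difference sets. -/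

theorem Finset.exists_median {ι : Type*} (s : Finset ι) (hs : s.Nonempty) (g : ι → ℝ) :
    ∃ c : ℝ, s.card ≤ 2 * (s.filter fun i => g i ≤ c).card ∧
      s.card ≤ 2 * (s.filter fun i => c ≤ g i).card := by
  classical
  let P := s.filter fun i => s.card ≤ 2 * (s.filter fun k => g k ≤ g i).card
  have hP : P.Nonempty := by
    obtain ⟨i, hi, hmax⟩ := s.exists_max_image g hs
    refine ⟨i, Finset.mem_filter.2 ⟨hi, ?_⟩⟩
    rw [Finset.filter_true_of_mem hmax]
    omega
  obtain ⟨i, hi, hmin⟩ := P.exists_min_image g hP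
  refine ⟨g i, (Finset.mem_filter.1 hi).2, ?_⟩
  -- Were fewer than half the values at or above `g i`, the largest value below it would already
  -- qualify, against minimality.
  by_contra! hlt
  have hsplit := Finset.card_filter_add_card_filter_not (s := s) (fun k => g i ≤ g k)
  have hQ : (s.filter fun k => ¬ g i ≤ g k).Nonempty := by
    rw [← Finset.card_pos]
    omega
  obtain ⟨k, hk, hkmax⟩ := Finset.exists_max_image _ g hQ
  simp only [Finset.mem_filter, not_le] at hk hkmax
  have hkP : k ∈ P := by
    refine Finset.mem_filter.2 ⟨hk.1, ?_⟩
    have : (s.filter fun l => ¬ g i ≤ g l) ⊆ s.filter fun l => g l ≤ g k := by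
      intro l hl
      simp only [Finset.mem_filter, not_le] at hl ⊢
      exact ⟨hl.1, hkmax l hl⟩
    have := Finset.card_le_card this
    omega
  exact absurd (hmin k hkP) (not_le.2 hk.2)

/-- Large subsets of `A` whose differences all lie on one side of each of the thresholds. -/
theorem exists_subsets_sub_one_sided (A : Finset ℝ) (hA : A.Nonempty) (R : Finset ℝ) :
    ∃ A₁ A₂ : Finset ℝ, A₁ ⊆ A ∧ A₂ ⊆ A ∧ A.card ≤ 2 ^ R.card * A₁.card ∧
      A.card ≤ 2 ^ R.card * A₂.card ∧
      ∀ t ∈ R, (∀ x ∈ A₁, ∀ y ∈ A₂, x - y ≤ t) ∨ (∀ x ∈ A₁, ∀ y ∈ A₂, t ≤ x - y) := by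
  classical
  induction R using Finset.induction_on with
  | empty => exact ⟨A, A, by simp⟩
  | insert t R ht ih =>
    obtain ⟨A₁, A₂, h₁, h₂, hc₁, hc₂, hR⟩ := ih
    have hpos := hA.card_pos
    have hn₁ : A₁.Nonempty := by
      rw [← Finset.card_pos]
      exact Nat.pos_of_mul_pos_left (hpos.trans_le hc₁)
    have hn₂ : A₂.Nonempty := by
      rw [← Finset.card_pos]
      exact Nat.pos_of_mul_pos_left (hpos.trans_le hc₂)
    obtain ⟨c₁, hl₁, hu₁⟩ := A₁.exists_median hn₁ id
    obtain ⟨c₂, hl₂, hu₂⟩ := A₂.exists_median hn₂ id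
    have hcard : ∀ {B C : Finset ℝ}, A.card ≤ 2 ^ R.card * B.card → B.card ≤ 2 * C.card →
        A.card ≤ 2 ^ (insert t R).card * C.card := by
      intro B C h h'
      rw [Finset.card_insert_of_notMem ht, pow_succ, mul_assoc]
      exact h.trans (Nat.mul_le_mul_left _ h')
    -- Lower half minus upper half stays below `c₁ - c₂`, upper half minus lower half above it; each
    -- threshold costs one factor 2.
    rcases le_total (c₁ - c₂) t with h | h
    · refine ⟨_, _, (Finset.filter_subset (fun i => id i ≤ c₁) A₁).trans h₁,
        (Finset.filter_subset (fun i => c₂ ≤ id i) A₂).trans h₂, hcard hc₁ hl₁,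
        hcard hc₂ hu₂, ?_⟩
      intro u hu
      rcases Finset.mem_insert.1 hu with rfl | hu
      · left
        intro x hx y hy
        have := (Finset.mem_filter.1 hx).2
        have := (Finset.mem_filter.1 hy).2
        simp only [id] at *
        linarith
      · exact (hR u hu).imp
          (fun h x hx y hy => h x (Finset.mem_filter.1 hx).1 y (Finset.mem_filter.1 hy).1)
          (fun h x hx y hy => h x (Finset.mem_filter.1 hx).1 y (Finset.mem_filter.1 hy).1)
    · refine ⟨_, _, (Finset.filter_subset (fun i => c₁ ≤ id i) A₁).trans h₁,
        (Finset.filter_subset (fun i => id i ≤ c₂) A₂).trans h₂, hcard hc₁ hu₁,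
        hcard hc₂ hl₂, ?_⟩
      intro u hu
      rcases Finset.mem_insert.1 hu with rfl | hu
      · right
        intro x hx y hy
        have := (Finset.mem_filter.1 hx).2
        have := (Finset.mem_filter.1 hy).2
        simp only [id] at *
        linarith
      · exact (hR u hu).imp
          (fun h x hx y hy => h x (Finset.mem_filter.1 hx).1 y (Finset.mem_filter.1 hy).1)
          (fun h x hx y hy => h x (Finset.mem_filter.1 hx).1 y (Finset.mem_filter.1 hy).1)

/-! ### Iterated sumsets. -/

theorem add_mem_iterSum {s t : ℕ} {S : Finset ℝ} {x y : ℝ} (hx : x ∈ iterSum s S)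
    (hy : y ∈ iterSum t S) : x + y ∈ iterSum (s + t) S := by
  rw [mem_iterSum] at *
  obtain ⟨u, hu, rfl⟩ := hx
  obtain ⟨v, hv, rfl⟩ := hy
  refine ⟨Fin.append u v, fun i => ?_, by simp [Fin.sum_univ_add]⟩
  refine Fin.addCases (fun i => ?_) (fun i => ?_) i
  · simpa using hu i
  · simpa using hv i

theorem mem_iterSum_one {S : Finset ℝ} {x : ℝ} (hx : x ∈ S) : x ∈ iterSum 1 S :=
  mem_iterSum.2 ⟨fun _ => x, fun _ => hx, by simp⟩

theorem add_mem_iterSum_two {S : Finset ℝ} {x y : ℝ} (hx : x ∈ S) (hy : y ∈ S) :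
    x + y ∈ iterSum 2 S :=
  mem_iterSum.2 ⟨![x, y], by simp [Fin.forall_fin_succ, hx, hy], by simp⟩

theorem add_mem_iterSum_three {S : Finset ℝ} {x y z : ℝ} (hx : x ∈ S) (hy : y ∈ S) (hz : z ∈ S) :
    x + y + z ∈ iterSum 3 S :=
  mem_iterSum.2 ⟨![x, y, z], by simp [Fin.forall_fin_succ, hx, hy, hz],
    by simp [Fin.sum_univ_succ, add_assoc]⟩

theorem add_mem_iterSum_four {S : Finset ℝ} {x y z w : ℝ} (hx : x ∈ S) (hy : y ∈ S) (hz : z ∈ S)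
    (hw : w ∈ S) : x + y + z + w ∈ iterSum 4 S :=
  mem_iterSum.2 ⟨![x, y, z, w], by simp [Fin.forall_fin_succ, hx, hy, hz, hw],
    by simp [Fin.sum_univ_succ, add_assoc]⟩

theorem iterSum_sub_subset {S : Finset ℝ} (hS : S.Nonempty) (s t k : ℕ) :
    iterSum s S - iterSum t S ⊆ iterSum (s + k) S - iterSum (t + k) S := by
  obtain ⟨e, he⟩ := hS
  have hk : (k : ℝ) * e ∈ iterSum k S := mem_iterSum.2 ⟨fun _ => e, fun _ => he, by simp⟩
  intro x hx
  obtain ⟨y, hy, z, hz, rfl⟩ := Finset.mem_sub.1 hx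
  exact Finset.mem_sub.2 ⟨_, add_mem_iterSum hy hk, _, add_mem_iterSum hz hk, by ring⟩

theorem iterSum_sub_nonempty {S : Finset ℝ} (hS : S.Nonempty) (s t : ℕ) :
    (iterSum s S - iterSum t S).Nonempty := by
  obtain ⟨e, he⟩ := hS
  exact Finset.Nonempty.sub ⟨_, mem_iterSum.2 ⟨fun _ => e, fun _ => he, rfl⟩⟩
    ⟨_, mem_iterSum.2 ⟨fun _ => e, fun _ => he, rfl⟩⟩

/-! ### Counting by fitting lengths into gaps. -/

/-- Points of the half-open gaps `(x i, x (i + 1)]` of an increasing sequence determine the gap. -/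
theorem eq_and_eq_of_add_eq_add_of_mem_gap {x : ℕ → ℝ} {p : ℕ}
    (hx : ∀ i < p, x i < x (i + 1)) {i k : ℕ} {s t : ℝ} (hi : i < p) (hk : k < p)
    (hs : 0 < s) (hs' : s ≤ x (i + 1) - x i) (ht : 0 < t) (ht' : t ≤ x (k + 1) - x k)
    (h : x i + s = x k + t) : i = k ∧ s = t := by
  have hmono : ∀ d j, j + d ≤ p → x j ≤ x (j + d) := by
    intro d
    induction d with
    | zero => intro j _; simp
    | succ d ih =>
      intro j hj
      exact (ih j (by omega)).trans (hx (j + d) (by omega)).le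
  rcases lt_trichotomy i k with hik | rfl | hik
  · have := hmono (k - (i + 1)) (i + 1) (by omega)
    rw [show i + 1 + (k - (i + 1)) = k by omega] at this
    linarith
  · exact ⟨rfl, by linarith⟩
  · have := hmono (i - (k + 1)) (k + 1) (by omega)
    rw [show k + 1 + (i - (k + 1)) = i by omega] at this
    linarith

/-- The translates x i + S sit in disjoint gaps, so all the sums are distinct. -/
theorem card_mul_card_le_of_gaps {x : ℕ → ℝ} {p : ℕ} (hx : ∀ i < p, x i < x (i + 1))
    {U : Finset ℕ} {S W : Finset ℝ} (hU : ∀ i ∈ U, i < p)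
    (hS : ∀ i ∈ U, ∀ s ∈ S, 0 < s ∧ s ≤ x (i + 1) - x i)
    (hW : ∀ i ∈ U, ∀ s ∈ S, x i + s ∈ W) : U.card * S.card ≤ W.card := by
  rw [← Finset.card_product]
  refine Finset.card_le_card_of_injOn (fun q => x q.1 + q.2) ?_ ?_
  · rintro ⟨i, s⟩ h
    have h := Finset.mem_product.1 (Finset.mem_coe.1 h)
    exact hW i h.1 s h.2
  · rintro ⟨i, s⟩ h ⟨k, t⟩ h' heq
    have h := Finset.mem_product.1 (Finset.mem_coe.1 h)
    have h' := Finset.mem_product.1 (Finset.mem_coe.1 h')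
    obtain ⟨h1, h2⟩ := eq_and_eq_of_add_eq_add_of_mem_gap hx (hU i h.1) (hU k h'.1)
      (hS i h.1 s h.2).1 (hS i h.1 s h.2).2 (hS k h'.1 t h'.2).1 (hS k h'.1 t h'.2).2 heq
    exact Prod.ext h1 h2

/-- A sequence with `T` distinct gaps has at least `T ^ 2 / 2` points `x j + gap` with a gap not
exceeding the one that follows `x j`. -/
theorem sq_card_gaps_le {x : ℕ → ℝ} {q : ℕ} (hx : ∀ j < q, x j < x (j + 1)) {W : Finset ℝ}
    (hW : ∀ j < q, ∀ k < q, x (k + 1) - x k ≤ x (j + 1) - x j →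
      x j + (x (k + 1) - x k) ∈ W) :
    ((Finset.range q).image fun j => x (j + 1) - x j).card ^ 2 ≤ 2 * W.card := by
  classical
  set V := (Finset.range q).image fun j => x (j + 1) - x j with hV
  have hrep : ∀ t ∈ V, ∃ j < q, x (j + 1) - x j = t := by
    intro t ht
    obtain ⟨j, hj, rfl⟩ := Finset.mem_image.1 ht
    exact ⟨j, Finset.mem_range.1 hj, rfl⟩
  choose! r hr hrt using hrep
  have hpos : ∀ t ∈ V, 0 < t := fun t ht => by
    have := hx _ (hr t ht)
    have := hrt t ht
    linarith
  -- Pairs of gap lengths whose second entry fits inside the first; by the swap symmetry they make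
  -- up at least half of all pairs.
  let D := (V ×ˢ V).filter fun c => c.2 ≤ c.1
  let D' := (V ×ˢ V).filter fun c => c.1 ≤ c.2
  have hDW : D.card ≤ W.card := by
    refine Finset.card_le_card_of_injOn (fun c => x (r c.1) + c.2) ?_ ?_
    · rintro ⟨s, t⟩ h
      obtain ⟨h, hle⟩ := Finset.mem_filter.1 (Finset.mem_coe.1 h)
      obtain ⟨hs, ht⟩ := Finset.mem_product.1 h
      simp only at hs ht hle
      have := hW (r s) (hr s hs) (r t) (hr t ht) (by rw [hrt s hs, hrt t ht]; exact hle)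
      rw [hrt t ht] at this
      exact this
    · rintro ⟨s, t⟩ h ⟨s', t'⟩ h' heq
      obtain ⟨h, hle⟩ := Finset.mem_filter.1 (Finset.mem_coe.1 h)
      obtain ⟨hs, ht⟩ := Finset.mem_product.1 h
      obtain ⟨h', hle'⟩ := Finset.mem_filter.1 (Finset.mem_coe.1 h')
      obtain ⟨hs', ht'⟩ := Finset.mem_product.1 h'
      simp only at hs ht hle hs' ht' hle' heq
      obtain ⟨h1, h2⟩ := eq_and_eq_of_add_eq_add_of_mem_gap hx (hr s hs) (hr s' hs')
        (hpos t ht) (by rw [hrt s hs]; exact hle) (hpos t' ht')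
        (by rw [hrt s' hs']; exact hle') heq
      have : s = s' := by rw [← hrt s hs, ← hrt s' hs', h1]
      exact Prod.ext this h2
  have hDD' : D.card = D'.card := by
    refine Finset.card_bij (fun c _ => c.swap) ?_ ?_ ?_
    · rintro ⟨s, t⟩ h
      simp only [D, D', Finset.mem_filter, Finset.mem_product, Prod.swap] at h ⊢
      tauto
    · rintro ⟨s, t⟩ _ ⟨s', t'⟩ _ h
      simpa using Prod.swap_injective h
    · rintro ⟨s, t⟩ h
      refine ⟨(t, s), ?_, rfl⟩
      simp only [D, D', Finset.mem_filter, Finset.mem_product] at h ⊢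
      tauto
  have hcover : V ×ˢ V ⊆ D ∪ D' := by
    rintro c hc
    rw [Finset.mem_union, Finset.mem_filter, Finset.mem_filter]
    exact (le_total c.2 c.1).imp (fun h => ⟨hc, h⟩) (fun h => ⟨hc, h⟩)
  have h1 := Finset.card_le_card hcover
  have h2 := Finset.card_union_le D D'
  rw [Finset.card_product] at h1
  nlinarith

/-- Cauchy–Schwarz for the fibres of a function. -/
theorem sq_card_le_card_image_mul_card_collisions {ι : Type*} [DecidableEq ι] (s : Finset ι)
    (g : ι → ℝ) :
    s.card ^ 2 ≤ (s.image g).card * (s.card + (s.offDiag.filter fun c => g c.1 = g c.2).card) := by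
  classical
  have h1 : s.card = ∑ v ∈ s.image g, (s.filter fun i => g i = v).card :=
    Finset.card_eq_sum_card_image g s
  have h2 : ∑ v ∈ s.image g, (s.filter fun i => g i = v).card ^ 2 =
      s.card + (s.offDiag.filter fun c => g c.1 = g c.2).card := by
    have h3 : ((s ×ˢ s).filter fun c => g c.1 = g c.2).card =
        ∑ v ∈ s.image g, (s.filter fun i => g i = v).card ^ 2 := by
      rw [Finset.card_eq_sum_card_fiberwise (f := fun c => g c.1) (t := s.image g)]
      · refine Finset.sum_congr rfl fun v _ => ?_
        rw [sq, ← Finset.card_product]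
        congr 1
        ext ⟨i, k⟩
        simp only [Finset.mem_filter, Finset.mem_product]
        constructor
        · rintro ⟨⟨⟨h, h'⟩, h''⟩, rfl⟩
          exact ⟨⟨h, rfl⟩, h', h''.symm⟩
        · rintro ⟨⟨h, rfl⟩, h', h''⟩
          exact ⟨⟨⟨h, h'⟩, h''.symm⟩, rfl⟩
      · rintro c hc
        have hc := (Finset.mem_filter.1 (Finset.mem_coe.1 hc)).1
        exact Finset.mem_coe.2 (Finset.mem_image_of_mem g (Finset.mem_product.1 hc).1)
    rw [← h3, ← Finset.diag_union_offDiag, Finset.filter_union, Finset.card_union_of_disjoint]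
    · congr 1
      rw [Finset.filter_true_of_mem, Finset.diag_card]
      rintro ⟨i, k⟩ h
      rw [(Finset.mem_diag.1 h).2]
    · exact Finset.disjoint_filter_filter (Finset.disjoint_diag_offDiag s)
  rw [← h2]
  conv_lhs => rw [h1]
  exact sq_sum_le_card_mul_sum_sq

theorem antitone_of_succ_lt {x : ℕ → ℝ} {p : ℕ} (hx : ∀ i < p, x (i + 1) < x i) :
    ∀ j ≤ p, x j ≤ x 0 := by
  intro j
  induction j with
  | zero => simp
  | succ j ih => exact fun hj => (hx j (by omega)).le.trans (ih (by omega))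

/-! ### Matrices with positive gaps and negative mixed differences. -/

section Matrix

variable {e : ℕ → ℕ → ℝ} {p : ℕ} {E : Finset ℝ}

/-- The p gaps of one row z below the median are distinct and fit into every row interval at or
above the median. -/
theorem sq_le_card_of_second_differences
    (hE : ∀ i ≤ p, ∀ j ≤ p, e i j ∈ E)
    (h1 : ∀ i < p, ∀ j ≤ p, e i j < e (i + 1) j)
    (h2 : ∀ i < p, ∀ j < p, e (i + 1) (j + 1) - e i (j + 1) < e (i + 1) j - e i j) :
    p ^ 2 ≤ 2 * (iterSum 2 E - iterSum 1 E).card := by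
  classical
  rcases Nat.eq_zero_or_pos p with rfl | hp
  · simp
  obtain ⟨c, hl, hu⟩ := (Finset.range p).exists_median ⟨0, Finset.mem_range.2 hp⟩
    fun i => e (i + 1) 0 - e i 0
  rw [Finset.card_range] at hl hu
  obtain ⟨z, hz⟩ : ((Finset.range p).filter fun i => e (i + 1) 0 - e i 0 ≤ c).Nonempty := by
    rw [← Finset.card_pos]
    omega
  obtain ⟨hzp, hzc⟩ := Finset.mem_filter.1 hz
  rw [Finset.mem_range] at hzp
  have hinj : Set.InjOn (fun j => e (z + 1) j - e z j) (Finset.range p : Set ℕ) := by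
    have : StrictAntiOn (fun j => e (z + 1) j - e z j) (Set.Iic p) := by
      refine strictAntiOn_of_succ_lt Set.ordConnected_Iic ?_
      intro j _ _ hj
      exact h2 z hzp j (Nat.lt_of_succ_le hj)
    exact this.injOn.mono fun j hj => by
      have := Finset.mem_range.1 (Finset.mem_coe.1 hj)
      exact Set.mem_Iic.2 this.le
  have hmain := card_mul_card_le_of_gaps (x := fun i => e i 0) (p := p)
    (U := (Finset.range p).filter fun i => c ≤ e (i + 1) 0 - e i 0)
    (S := (Finset.range p).image fun j => e (z + 1) j - e z j)
    (W := iterSum 2 E - iterSum 1 E) (fun i hi => h1 i hi 0 (by omega))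
    (fun i hi => Finset.mem_range.1 (Finset.mem_filter.1 hi).1) ?_ ?_
  · rw [Finset.card_image_of_injOn hinj, Finset.card_range] at hmain
    nlinarith
  · intro i hi s hs
    obtain ⟨j, hj, rfl⟩ := Finset.mem_image.1 hs
    have hj := Finset.mem_range.1 hj
    have := h1 z hzp j hj.le
    have : e (z + 1) j - e z j ≤ e (z + 1) 0 - e z 0 :=
      antitone_of_succ_lt (x := fun j => e (z + 1) j - e z j) (h2 z hzp) j hj.le
    have := (Finset.mem_filter.1 hi).2
    exact ⟨by linarith, by linarith⟩
  · intro i hi s hs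
    obtain ⟨j, hj, rfl⟩ := Finset.mem_image.1 hs
    have hj := Finset.mem_range.1 hj
    have hip := Finset.mem_range.1 (Finset.mem_filter.1 hi).1
    exact Finset.mem_sub.2 ⟨e i 0 + e (z + 1) j,
      add_mem_iterSum_two (hE _ hip.le _ (Nat.zero_le _)) (hE _ hzp _ hj.le), e z j,
      mem_iterSum_one (hE _ hzp.le _ hj.le), by ring⟩

/-- Here `h3` makes a typical row have many distinct mixed differences, so that `sq_card_gaps_le`
supplies quadratically many lengths to fit into the large gaps. -/
theorem cube_le_card_of_second_differences {m : ℕ}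
    (hE : ∀ i ≤ p, ∀ j ≤ p, e i j ∈ E)
    (h1 : ∀ i < p, ∀ j ≤ p, e i j < e (i + 1) j)
    (h2 : ∀ i < p, ∀ j < p, e (i + 1) (j + 1) - e i (j + 1) < e (i + 1) j - e i j)
    (h3 : ∀ j < p, ∀ k < p, j ≠ k → ((Finset.range p).filter fun i =>
      (e (i + 1) j - e i j) - (e (i + 1) (j + 1) - e i (j + 1)) =
        (e (i + 1) k - e i k) - (e (i + 1) (k + 1) - e i (k + 1))).card ≤ m) :
    p ^ 3 ≤ 4 * (2 * m + 1) ^ 2 * (iterSum 4 E - iterSum 3 E).card := by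
  classical
  rcases Nat.eq_zero_or_pos p with rfl | hp
  · simp
  obtain ⟨c, hl, hu⟩ := (Finset.range p).exists_median ⟨0, Finset.mem_range.2 hp⟩
    fun i => e (i + 1) 0 - e i 0
  rw [Finset.card_range] at hl hu
  set L := (Finset.range p).filter fun i => e (i + 1) 0 - e i 0 ≤ c with hL
  set F : ℕ → ℕ → ℝ := fun i j =>
    (e (i + 1) j - e i j) - (e (i + 1) (j + 1) - e i (j + 1)) with hF
  let K : ℕ → ℕ := fun i => ((Finset.range p).offDiag.filter fun c => F i c.1 = F i c.2).card
  have hLne : L.Nonempty := by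
    rw [← Finset.card_pos]
    omega
  have hsum : ∑ i ∈ L, K i ≤ m * p ^ 2 := by
    calc ∑ i ∈ L, K i ≤ ∑ i ∈ Finset.range p, K i :=
          Finset.sum_le_sum_of_subset (Finset.filter_subset _ _)
      _ = ∑ c ∈ (Finset.range p).offDiag,
            ((Finset.range p).filter fun i => F i c.1 = F i c.2).card := by
          simp only [K, Finset.card_filter]
          exact Finset.sum_comm
      _ ≤ ∑ c ∈ (Finset.range p).offDiag, m := by
          refine Finset.sum_le_sum fun c hc => ?_
          obtain ⟨ha, hb, hab⟩ := Finset.mem_offDiag.1 hc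
          exact h3 _ (Finset.mem_range.1 ha) _ (Finset.mem_range.1 hb) hab
      _ ≤ m * p ^ 2 := by
          rw [Finset.sum_const, smul_eq_mul, Finset.offDiag_card, Finset.card_range, mul_comm, sq]
          exact Nat.mul_le_mul_left _ (Nat.sub_le _ _)
  -- Averaging over `L`, which holds at least half of the rows, gives a row with at most 2mp
  -- collisions.
  obtain ⟨z, hz, hzmin⟩ := L.exists_min_image K hLne
  have hKz : L.card * K z ≤ m * p ^ 2 := by
    refine le_trans ?_ hsum
    rw [← smul_eq_mul]
    exact Finset.card_nsmul_le_sum _ _ _ hzmin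
  have hKz' : K z ≤ 2 * m * p := by
    have : p * K z ≤ p * (2 * m * p) := by nlinarith
    exact Nat.le_of_mul_le_mul_left this hp
  obtain ⟨hzp, hzc⟩ := Finset.mem_filter.1 hz
  rw [Finset.mem_range] at hzp
  have hT : p ≤ (2 * m + 1) * ((Finset.range p).image (F z)).card := by
    have := sq_card_le_card_image_mul_card_collisions (Finset.range p) (F z)
    rw [Finset.card_range] at this
    have h' : p * p ≤ p * ((2 * m + 1) * ((Finset.range p).image (F z)).card) := by
      calc p * p = p ^ 2 := by ring
        _ ≤ _ := this
        _ ≤ ((Finset.range p).image (F z)).card * (p + 2 * m * p) := by gcongr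
        _ = _ := by ring
    exact Nat.le_of_mul_le_mul_left h' hp
  -- The gaps of row z decrease in j; the sign makes them an increasing sequence, and negating again
  -- below restores positive lengths.
  let x : ℕ → ℝ := fun j => -(e (z + 1) j - e z j)
  have hxF : ∀ j, x (j + 1) - x j = F z j := fun j => by simp only [x, hF]; ring
  have hx : ∀ j < p, x j < x (j + 1) := fun j hj => by
    have := h2 z hzp j hj
    simp only [x]
    linarith
  let D := ((Finset.range p ×ˢ Finset.range p).filter fun c => F z c.2 ≤ F z c.1)
  have hS := sq_card_gaps_le (q := p) (W := D.image fun c => x c.1 + F z c.2) hx (by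
    intro j hj k hk hjk
    rw [hxF, hxF] at *
    exact Finset.mem_image.2 ⟨(j, k), Finset.mem_filter.2 ⟨Finset.mem_product.2
      ⟨Finset.mem_range.2 hj, Finset.mem_range.2 hk⟩, hjk⟩, rfl⟩)
  simp only [hxF] at hS
  have hneg := Finset.card_image_of_injective (D.image fun c => x c.1 + F z c.2)
    (neg_injective (G := ℝ))
  rw [Finset.image_image] at hneg
  have hmain := card_mul_card_le_of_gaps (x := fun i => e i 0) (p := p)
    (U := (Finset.range p).filter fun i => c ≤ e (i + 1) 0 - e i 0)
    (S := D.image (Neg.neg ∘ fun c => x c.1 + F z c.2))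
    (W := iterSum 4 E - iterSum 3 E) (fun i hi => h1 i hi 0 (by omega))
    (fun i hi => Finset.mem_range.1 (Finset.mem_filter.1 hi).1) ?_ ?_
  · rw [hneg] at hmain
    set T := ((Finset.range p).image (F z)).card
    set s := (D.image fun c => x c.1 + F z c.2).card
    set u := ((Finset.range p).filter fun i => c ≤ e (i + 1) 0 - e i 0).card
    calc p ^ 3 = p * p ^ 2 := by ring
      _ ≤ (2 * u) * ((2 * m + 1) * T) ^ 2 := by gcongr
      _ = 2 * (2 * m + 1) ^ 2 * u * T ^ 2 := by ring
      _ ≤ 2 * (2 * m + 1) ^ 2 * u * (2 * s) := by gcongr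
      _ = 4 * (2 * m + 1) ^ 2 * (u * s) := by ring
      _ ≤ _ := by gcongr
  · intro i hi s hs
    obtain ⟨⟨j, k⟩, hjk, rfl⟩ := Finset.mem_image.1 hs
    obtain ⟨hjk, hle⟩ := Finset.mem_filter.1 hjk
    obtain ⟨hj, hk⟩ := Finset.mem_product.1 hjk
    simp only [Finset.mem_range] at hj hk hle
    have a1 := h1 z hzp (j + 1) (by omega)
    have a2 : e (z + 1) j - e z j ≤ e (z + 1) 0 - e z 0 :=
      antitone_of_succ_lt (x := fun j => e (z + 1) j - e z j) (h2 z hzp) j hj.le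
    have a3 := (Finset.mem_filter.1 hi).2
    have a4 := h2 z hzp k hk
    simp only [hF] at hle
    simp only [Function.comp, x, hF]
    exact ⟨by linarith, by linarith⟩
  · intro i hi s hs
    obtain ⟨⟨j, k⟩, hjk, rfl⟩ := Finset.mem_image.1 hs
    obtain ⟨hj, hk⟩ := Finset.mem_product.1 (Finset.mem_filter.1 hjk).1
    simp only [Finset.mem_range] at hj hk
    have hip := Finset.mem_range.1 (Finset.mem_filter.1 hi).1
    refine Finset.mem_sub.2 ⟨e i 0 + e (z + 1) j + e z k + e (z + 1) (k + 1),
      add_mem_iterSum_four (hE _ hip.le _ (Nat.zero_le _)) (hE _ hzp _ hj.le)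
        (hE _ hzp.le _ hk.le) (hE _ hzp _ hk),
      e z j + e (z + 1) k + e z (k + 1),
      add_mem_iterSum_three (hE _ hzp.le _ hj.le) (hE _ hzp _ hk.le) (hE _ hzp.le _ hk), ?_⟩
    simp only [Function.comp, x, hF]
    ring

end Matrix

/-! ### Monotonicity and Rolle for polynomials. -/

theorem strictMonoOn_or_strictAntiOn_eval (g : ℝ[X]) {lo hi : ℝ} (hlt : lo ≤ hi)
    (hg : ∀ t ∈ Set.Ioo lo hi, g.derivative.eval t ≠ 0) :
    StrictMonoOn (fun x => g.eval x) (Set.Icc lo hi) ∨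
      StrictAntiOn (fun x => g.eval x) (Set.Icc lo hi) := by
  refine ContinuousOn.strictMonoOn_of_injOn_Icc' hlt g.continuous.continuousOn ?_
  have key : ∀ x ∈ Set.Icc lo hi, ∀ y ∈ Set.Icc lo hi, x < y → g.eval x ≠ g.eval y := by
    intro x hx y hy hxy h
    obtain ⟨t, ht, h0⟩ := exists_hasDerivAt_eq_zero hxy g.continuous.continuousOn h
      fun t _ => g.hasDerivAt t
    exact hg t ⟨hx.1.trans_lt ht.1, ht.2.trans_le hy.2⟩ h0
  intro x hx y hy h
  by_contra hne
  rcases lt_or_gt_of_ne hne with hlt' | hlt'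
  · exact key x hx y hy hlt' h
  · exact key y hy x hx hlt' h.symm

/-- A polynomial with strictly increasing derivative has increasing differences. -/
theorem eval_sub_eval_lt_of_strictMonoOn_derivative (g : ℝ[X]) {lo hi : ℝ}
    (hg : StrictMonoOn (fun x => g.derivative.eval x) (Set.Icc lo hi)) {a a' b b' : ℝ}
    (ha : a < a') (hb : b < b') (hlo : lo ≤ a - b') (hhi : a' - b ≤ hi) :
    g.eval (a' - b') - g.eval (a - b') < g.eval (a' - b) - g.eval (a - b) := by
  let h : ℝ[X] := g.comp (Polynomial.C a' - Polynomial.X) - g.comp (Polynomial.C a - Polynomial.X)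
  have hh : ∀ x, h.eval x = g.eval (a' - x) - g.eval (a - x) := fun x => by simp [h]
  have hd : ∀ x, h.derivative.eval x = g.derivative.eval (a - x) - g.derivative.eval (a' - x) :=
    fun x => by simp [h, Polynomial.derivative_comp]; ring
  -- Mean value theorem in the subtracted variable.
  obtain ⟨t, ht, heq⟩ := exists_hasDerivAt_eq_slope (fun x => h.eval x) _ hb
    h.continuous.continuousOn fun t _ => h.hasDerivAt t
  have hlt : g.derivative.eval (a - t) < g.derivative.eval (a' - t) :=
    hg ⟨by linarith [ht.2], by linarith [ht.1]⟩ ⟨by linarith [ht.2], by linarith [ht.1]⟩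
      (by linarith)
  have hneg : (h.eval b' - h.eval b) / (b' - b) < 0 := by
    rw [← heq, hd]
    linarith
  have : h.eval b' - h.eval b < 0 := by
    by_contra! h0
    exact absurd hneg (not_lt.2 (div_nonneg h0 (by linarith)))
  rw [hh, hh] at this
  linarith

theorem Finset.exists_strictMono_seq {A : Finset ℝ} {p : ℕ} (hp : p + 1 ≤ A.card) :
    ∃ a : ℕ → ℝ, (∀ i ≤ p, a i ∈ A) ∧ ∀ i k, i < k → k ≤ p → a i < a k := by
  obtain ⟨B, hBA, hB⟩ := Finset.exists_subset_card_eq hp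
  refine ⟨fun i => if h : i < p + 1 then B.orderEmbOfFin hB ⟨i, h⟩ else 0, ?_, ?_⟩
  · intro i hi
    simp only [dif_pos (Nat.lt_succ_of_le hi)]
    exact hBA (Finset.orderEmbOfFin_mem _ _ _)
  · intro i k hik hk
    simp only [dif_pos (Nat.lt_succ_of_le hk), dif_pos (Nat.lt_succ_of_le (hik.le.trans hk))]
    exact (B.orderEmbOfFin hB).strictMono hik

theorem Finset.exists_strictAnti_seq {A : Finset ℝ} {p : ℕ} (hp : p + 1 ≤ A.card) :
    ∃ a : ℕ → ℝ, (∀ i ≤ p, a i ∈ A) ∧ ∀ i k, i < k → k ≤ p → a k < a i := by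
  obtain ⟨a, ha, hlt⟩ := Finset.exists_strictMono_seq hp
  exact ⟨fun i => a (p - i), fun i _ => ha _ (by omega),
    fun i k hik hk => hlt _ _ (by omega) (by omega)⟩

/-- Rolle: a nonconstant polynomial repeats its value on few neighbouring pairs. -/
theorem card_filter_eval_eq_eval_succ_le {g : ℝ[X]} (hg : g.derivative ≠ 0) {a : ℕ → ℝ} {p : ℕ}
    (ha : (∀ i k, i < k → k ≤ p → a i < a k) ∨ (∀ i k, i < k → k ≤ p → a k < a i)) :
    ((Finset.range p).filter fun i => g.eval (a (i + 1)) = g.eval (a i)).card ≤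
      g.derivative.natDegree := by
  classical
  have key : ∀ i ∈ (Finset.range p).filter fun i => g.eval (a (i + 1)) = g.eval (a i),
      ∃ t, g.derivative.eval t = 0 ∧ min (a i) (a (i + 1)) < t ∧ t < max (a i) (a (i + 1)) := by
    intro i hi
    obtain ⟨hi, heq⟩ := Finset.mem_filter.1 hi
    rw [Finset.mem_range] at hi
    have hne : min (a i) (a (i + 1)) < max (a i) (a (i + 1)) := by
      rw [min_lt_max]
      exact ha.elim (fun h => (h i (i + 1) (by omega) hi).ne)
        (fun h => (h i (i + 1) (by omega) hi).ne')
    have heq' : g.eval (min (a i) (a (i + 1))) = g.eval (max (a i) (a (i + 1))) := by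
      rcases le_total (a i) (a (i + 1)) with h | h
      · rw [min_eq_left h, max_eq_right h, heq]
      · rw [min_eq_right h, max_eq_left h, heq]
    obtain ⟨t, ht, h0⟩ := exists_hasDerivAt_eq_zero hne g.continuous.continuousOn heq'
      fun t _ => g.hasDerivAt t
    exact ⟨t, h0, ht.1, ht.2⟩
  choose! t ht0 htl htr using key
  -- The Rolle points lie between consecutive terms of a monotone sequence, hence in disjoint open
  -- intervals.
  have hne : ∀ i ∈ (Finset.range p).filter fun i => g.eval (a (i + 1)) = g.eval (a i),
      ∀ k ∈ (Finset.range p).filter fun i => g.eval (a (i + 1)) = g.eval (a i),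
      i < k → t i ≠ t k := by
    intro i hi k hk hik heq
    have hip := Finset.mem_range.1 (Finset.mem_filter.1 hi).1
    have hkp := Finset.mem_range.1 (Finset.mem_filter.1 hk).1
    have l1 := htl i hi
    have r1 := htr i hi
    have l2 := htl k hk
    have r2 := htr k hk
    rcases ha with ha | ha
    · have h1 := ha i (i + 1) (by omega) (by omega)
      have h2 := ha k (k + 1) (by omega) (by omega)
      have h3 : a (i + 1) ≤ a k := by
        rcases Nat.eq_or_lt_of_le (Nat.succ_le_of_lt hik) with h | h
        · exact (congrArg a h).le
        · exact (ha _ _ h (by omega)).le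
      rw [max_eq_right h1.le] at r1
      rw [min_eq_left h2.le] at l2
      linarith
    · have h1 := ha i (i + 1) (by omega) (by omega)
      have h2 := ha k (k + 1) (by omega) (by omega)
      have h3 : a k ≤ a (i + 1) := by
        rcases Nat.eq_or_lt_of_le (Nat.succ_le_of_lt hik) with h | h
        · exact (congrArg a h).ge
        · exact (ha _ _ h (by omega)).le
      rw [min_eq_right h1.le] at l1
      rw [max_eq_left h2.le] at r2
      linarith
  calc _ ≤ g.derivative.roots.toFinset.card := by
        refine Finset.card_le_card_of_injOn t ?_ ?_
        · intro i hi
          have := ht0 i (Finset.mem_coe.1 hi)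
          simp [hg, this]
        · intro i hi k hk heq
          by_contra hik
          rcases Nat.lt_or_gt_of_ne hik with h | h
          · exact hne i hi k hk h heq
          · exact hne k hk i hi h heq.symm
    _ ≤ Multiset.card g.derivative.roots := Multiset.toFinset_card_le _
    _ ≤ _ := Polynomial.card_roots' _

open Polynomial in
/-- The alternating sum of four translates of `f`. -/
noncomputable def translateDiff (f : ℝ[X]) (b b' c c' : ℝ) : ℝ[X] :=
  (f.comp (X - C b) - f.comp (X - C b')) - (f.comp (X - C c) - f.comp (X - C c'))

theorem derivative_translateDiff (f : ℝ[X]) (b b' c c' : ℝ) :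
    (translateDiff f b b' c c').derivative = translateDiff f.derivative b b' c c' := by
  simp [translateDiff, Polynomial.derivative_comp]

/-- Vanishing passes to the derivative, which reduces to degree 2. There the linear coefficient
forces b - b' = c - c', and the constant term becomes a nonzero multiple of (b - b')(b - c). -/
theorem translateDiff_ne_zero {b b' c c' : ℝ} (hb : b ≠ b') (hbc : b ≠ c) (f : ℝ[X])
    (hf : 2 ≤ f.natDegree) : translateDiff f b b' c c' ≠ 0 := by
  obtain ⟨d, hd⟩ := Nat.exists_eq_add_of_le hf
  clear hf
  induction d generalizing f with
  | zero =>
    intro h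
    have hlead : f.coeff 2 ≠ 0 := by
      have : f.natDegree = 2 := by omega
      rw [← this, Polynomial.coeff_natDegree]
      intro h0
      rw [Polynomial.leadingCoeff_eq_zero] at h0
      simp [h0] at this
    have heval : ∀ y, f.eval y = f.coeff 0 + f.coeff 1 * y + f.coeff 2 * y ^ 2 := by
      intro y
      rw [Polynomial.eval_eq_sum_range, hd]
      simp [Finset.sum_range_succ]
    have h0 := congrArg (Polynomial.eval 0) h
    have h1 := congrArg (Polynomial.eval 1) h
    simp only [translateDiff, Polynomial.eval_sub, Polynomial.eval_comp, Polynomial.eval_X,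
      Polynomial.eval_C, heval, Polynomial.eval_zero] at h0 h1
    have e1 : f.coeff 2 * ((b - b') - (c - c')) = 0 := by linear_combination (h0 - h1) / 2
    have e1' : c' = c - b + b' := by
      have := (mul_eq_zero.1 e1).resolve_left hlead
      linarith
    subst e1'
    have e2 : f.coeff 2 * (2 * (b - b') * (b - c)) = 0 := by linear_combination h0
    have := (mul_eq_zero.1 e2).resolve_left hlead
    rcases mul_eq_zero.1 this with h | h
    · exact hb (by linarith)
    · exact hbc (by linarith)
  | succ d ih =>
    intro h
    refine ih f.derivative ?_ ?_
    · rw [Polynomial.natDegree_derivative, hd]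
      omega
    · rw [← derivative_translateDiff, h, Polynomial.derivative_zero]

theorem natDegree_translateDiff_le (f : ℝ[X]) (b b' c c' : ℝ) :
    (translateDiff f b b' c c').natDegree ≤ f.natDegree := by
  have h : ∀ x, (f.comp (Polynomial.X - Polynomial.C x)).natDegree ≤ f.natDegree := fun x => by
    rw [Polynomial.natDegree_comp, Polynomial.natDegree_X_sub_C, mul_one]
  exact (Polynomial.natDegree_sub_le_of_le (Polynomial.natDegree_sub_le_of_le (h _) (h _))
    (Polynomial.natDegree_sub_le_of_le (h _) (h _))).trans (by simp)

/-! ### Grids on which f and f' are monotone. -/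

/-- The order of a is chosen to make f increase along it, then that of b to make the mixed
difference negative. -/
theorem exists_grid_of_monotone (f : ℝ[X]) {A B : Finset ℝ} {lo hi : ℝ} (hle : lo ≤ hi)
    (hAB : ∀ x ∈ A, ∀ y ∈ B, lo ≤ x - y ∧ x - y ≤ hi)
    (hf : ∀ t ∈ Set.Ioo lo hi, f.derivative.eval t ≠ 0)
    (hf' : ∀ t ∈ Set.Ioo lo hi, f.derivative.derivative.eval t ≠ 0) {p : ℕ}
    (hA : p + 1 ≤ A.card) (hB : p + 1 ≤ B.card) :
    ∃ a b : ℕ → ℝ, (∀ i ≤ p, a i ∈ A) ∧ (∀ j ≤ p, b j ∈ B) ∧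
      ((∀ i k, i < k → k ≤ p → a i < a k) ∨ (∀ i k, i < k → k ≤ p → a k < a i)) ∧
      ((∀ i k, i < k → k ≤ p → b i < b k) ∨ (∀ i k, i < k → k ≤ p → b k < b i)) ∧
      (∀ i < p, ∀ j ≤ p, f.eval (a i - b j) < f.eval (a (i + 1) - b j)) ∧
      (∀ i < p, ∀ j < p, f.eval (a (i + 1) - b (j + 1)) - f.eval (a i - b (j + 1)) <
        f.eval (a (i + 1) - b j) - f.eval (a i - b j)) := by
  have hQ : (∀ x ∈ A, ∀ x' ∈ A, ∀ y ∈ B, ∀ y' ∈ B, x < x' → y < y' →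
      f.eval (x' - y') - f.eval (x - y') < f.eval (x' - y) - f.eval (x - y)) ∨
      (∀ x ∈ A, ∀ x' ∈ A, ∀ y ∈ B, ∀ y' ∈ B, x < x' → y < y' →
      f.eval (x' - y) - f.eval (x - y) < f.eval (x' - y') - f.eval (x - y')) := by
    refine (strictMonoOn_or_strictAntiOn_eval f.derivative hle hf').imp ?_ ?_
    · intro h x hx x' hx' y hy y' hy' hlt hlt'
      exact eval_sub_eval_lt_of_strictMonoOn_derivative f h hlt hlt' (hAB x hx y' hy').1
        (hAB x' hx' y hy).2
    · intro h x hx x' hx' y hy y' hy' hlt hlt'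
      have hneg : StrictMonoOn (fun x => (-f).derivative.eval x) (Set.Icc lo hi) := by
        intro u hu v hv huv
        have := h hu hv huv
        simp only [Polynomial.derivative_neg, Polynomial.eval_neg] at this ⊢
        linarith
      have := eval_sub_eval_lt_of_strictMonoOn_derivative (-f) hneg hlt hlt' (hAB x hx y' hy').1
        (hAB x' hx' y hy).2
      simp only [Polynomial.eval_neg] at this
      linarith
  obtain ⟨a, haA, ha⟩ := Finset.exists_strictMono_seq hA
  obtain ⟨a', haA', ha'⟩ := Finset.exists_strictAnti_seq hA
  obtain ⟨b, hbB, hb⟩ := Finset.exists_strictMono_seq hB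
  obtain ⟨b', hbB', hb'⟩ := Finset.exists_strictAnti_seq hB
  rcases strictMonoOn_or_strictAntiOn_eval f hle hf with hm | hm
  · have h1 : ∀ c : ℕ → ℝ, (∀ j ≤ p, c j ∈ B) → ∀ i < p, ∀ j ≤ p,
        f.eval (a i - c j) < f.eval (a (i + 1) - c j) := fun c hc i hi j hj =>
      hm (hAB _ (haA _ hi.le) _ (hc _ hj)) (hAB _ (haA _ hi) _ (hc _ hj))
        (by linarith [ha i (i + 1) (by omega) hi])
    rcases hQ with hQ | hQ
    · exact ⟨a, b, haA, hbB, Or.inl ha, Or.inl hb, h1 b hbB, fun i hi j hj =>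
        hQ _ (haA _ hi.le) _ (haA _ hi) _ (hbB _ hj.le) _ (hbB _ hj)
          (ha i (i + 1) (by omega) hi) (hb j (j + 1) (by omega) hj)⟩
    · exact ⟨a, b', haA, hbB', Or.inl ha, Or.inr hb', h1 b' hbB', fun i hi j hj =>
        hQ _ (haA _ hi.le) _ (haA _ hi) _ (hbB' _ hj) _ (hbB' _ hj.le)
          (ha i (i + 1) (by omega) hi) (hb' j (j + 1) (by omega) hj)⟩
  · have h1 : ∀ c : ℕ → ℝ, (∀ j ≤ p, c j ∈ B) → ∀ i < p, ∀ j ≤ p,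
        f.eval (a' i - c j) < f.eval (a' (i + 1) - c j) := fun c hc i hi j hj =>
      hm (hAB _ (haA' _ hi) _ (hc _ hj)) (hAB _ (haA' _ hi.le) _ (hc _ hj))
        (by linarith [ha' i (i + 1) (by omega) hi])
    rcases hQ with hQ | hQ
    · refine ⟨a', b', haA', hbB', Or.inr ha', Or.inr hb', h1 b' hbB', fun i hi j hj => ?_⟩
      have := hQ _ (haA' _ hi) _ (haA' _ hi.le) _ (hbB' _ hj) _ (hbB' _ hj.le)
          (ha' i (i + 1) (by omega) hi) (hb' j (j + 1) (by omega) hj)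
      linarith
    · refine ⟨a', b, haA', hbB, Or.inr ha', Or.inl hb, h1 b hbB, fun i hi j hj => ?_⟩
      have := hQ _ (haA' _ hi) _ (haA' _ hi.le) _ (hbB _ hj.le) _ (hbB _ hj)
          (ha' i (i + 1) (by omega) hi) (hb j (j + 1) (by omega) hj)
      linarith

theorem exists_grid (f : ℝ[X]) {m : ℕ} (hm : 2 ≤ m) (hf : f.natDegree = m) {A : Finset ℝ}
    (hA : A.Nonempty) :
    ∃ (p : ℕ) (a b : ℕ → ℝ), A.card ≤ 2 ^ (2 * m) * (p + 1) ∧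
      (∀ i ≤ p, a i ∈ A) ∧ (∀ j ≤ p, b j ∈ A) ∧
      ((∀ i k, i < k → k ≤ p → a i < a k) ∨ (∀ i k, i < k → k ≤ p → a k < a i)) ∧
      ((∀ i k, i < k → k ≤ p → b i < b k) ∨ (∀ i k, i < k → k ≤ p → b k < b i)) ∧
      (∀ i < p, ∀ j ≤ p, f.eval (a i - b j) < f.eval (a (i + 1) - b j)) ∧
      (∀ i < p, ∀ j < p, f.eval (a (i + 1) - b (j + 1)) - f.eval (a i - b (j + 1)) <
        f.eval (a (i + 1) - b j) - f.eval (a i - b j)) := by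
  classical
  have hd : f.derivative.natDegree = m - 1 := by rw [Polynomial.natDegree_derivative, hf]
  have hd' : f.derivative.derivative.natDegree = m - 1 - 1 := by
    rw [Polynomial.natDegree_derivative, hd]
  have hf1 : f.derivative ≠ 0 := by
    intro h
    rw [h, Polynomial.natDegree_zero] at hd
    omega
  have hf2 : f.derivative.derivative ≠ 0 := by
    intro h
    have := Polynomial.derivative_eq_zero.1 h
    omega
  set R := f.derivative.roots.toFinset ∪ f.derivative.derivative.roots.toFinset with hR
  have hRcard : R.card ≤ 2 * m := by
    have h1 := (Multiset.toFinset_card_le _).trans (Polynomial.card_roots' f.derivative)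
    have h2 := (Multiset.toFinset_card_le _).trans (Polynomial.card_roots' f.derivative.derivative)
    have h3 : R.card ≤ _ := Finset.card_union_le _ _
    omega
  obtain ⟨A₁, A₂, hA₁, hA₂, hc₁, hc₂, hside⟩ := exists_subsets_sub_one_sided A hA R
  have hpow : 2 ^ R.card ≤ 2 ^ (2 * m) := Nat.pow_le_pow_right (by norm_num) hRcard
  have hpos := hA.card_pos
  have hp₁ : 0 < A₁.card := Nat.pos_of_mul_pos_left (hpos.trans_le hc₁)
  have hp₂ : 0 < A₂.card := Nat.pos_of_mul_pos_left (hpos.trans_le hc₂)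
  have hn₁ := Finset.card_pos.1 hp₁
  have hn₂ := Finset.card_pos.1 hp₂
  have hAB : ∀ x ∈ A₁, ∀ y ∈ A₂, A₁.min' hn₁ - A₂.max' hn₂ ≤ x - y ∧
      x - y ≤ A₁.max' hn₁ - A₂.min' hn₂ := fun x hx y hy =>
    ⟨sub_le_sub (A₁.min'_le x hx) (A₂.le_max' y hy),
      sub_le_sub (A₁.le_max' x hx) (A₂.min'_le y hy)⟩
  -- The endpoints are themselves differences, so a root strictly inside would have differences on
  -- both sides of it.
  have hroot : ∀ t ∈ Set.Ioo (A₁.min' hn₁ - A₂.max' hn₂) (A₁.max' hn₁ - A₂.min' hn₂), t ∉ R := by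
    intro t ht htR
    rcases hside t htR with h | h
    · exact absurd (h _ (A₁.max'_mem hn₁) _ (A₂.min'_mem hn₂)) (not_le.2 ht.2)
    · exact absurd (h _ (A₁.min'_mem hn₁) _ (A₂.max'_mem hn₂)) (not_le.2 ht.1)
  obtain ⟨p, hp⟩ : ∃ p, min A₁.card A₂.card = p + 1 :=
    Nat.exists_eq_succ_of_ne_zero (lt_min hp₁ hp₂).ne'
  obtain ⟨x, hx⟩ := hn₁
  obtain ⟨y, hy⟩ := hn₂
  obtain ⟨a, b, ha, hb, h⟩ := exists_grid_of_monotone f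
    ((hAB x hx y hy).1.trans (hAB x hx y hy).2) hAB
    (fun t ht h0 => hroot t ht (by simp [hR, hf1, h0]))
    (fun t ht h0 => hroot t ht (by simp [hR, hf2, h0])) (p := p)
    (hp ▸ min_le_left _ _) (hp ▸ min_le_right _ _)
  refine ⟨p, a, b, ?_, fun i hi => hA₁ (ha i hi), fun j hj => hA₂ (hb j hj), h⟩
  rw [← hp]
  rcases min_choice A₁.card A₂.card with h | h <;> rw [h]
  · exact hc₁.trans (Nat.mul_le_mul_right _ hpow)
  · exact hc₂.trans (Nat.mul_le_mul_right _ hpow)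

theorem polyDiffImage_nonempty (f : ℝ[X]) {A : Finset ℝ} (hA : A.Nonempty) :
    (polyDiffImage f A).Nonempty := (hA.sub hA).image _

theorem exists_sq_card_le (f : ℝ[X]) {m : ℕ} (hm : 2 ≤ m) (hf : f.natDegree = m) {A : Finset ℝ}
    (hA : A.Nonempty) :
    ∃ p : ℕ, A.card ≤ 2 ^ (2 * m) * (p + 1) ∧
      p ^ 2 ≤ 2 * (iterSum 2 (polyDiffImage f A) - iterSum 1 (polyDiffImage f A)).card := by
  obtain ⟨p, a, b, hp, ha, hb, -, -, h1, h2⟩ := exists_grid f hm hf hA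
  exact ⟨p, hp, sq_le_card_of_second_differences (e := fun i j => f.eval (a i - b j))
    (fun i hi j hj => mem_polyDiffImage.2 ⟨_, ha i hi, _, hb j hj, rfl⟩) h1 h2⟩

theorem exists_cube_card_le (f : ℝ[X]) {m : ℕ} (hm : 3 ≤ m) (hf : f.natDegree = m) {A : Finset ℝ}
    (hA : A.Nonempty) :
    ∃ p : ℕ, A.card ≤ 2 ^ (2 * m) * (p + 1) ∧
      p ^ 3 ≤ 4 * (2 * m + 1) ^ 2 *
        (iterSum 4 (polyDiffImage f A) - iterSum 3 (polyDiffImage f A)).card := by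
  obtain ⟨p, a, b, hp, ha, hb, hamono, hbmono, h1, h2⟩ := exists_grid f (by omega) hf hA
  refine ⟨p, hp, cube_le_card_of_second_differences (e := fun i j => f.eval (a i - b j))
    (fun i hi j hj => mem_polyDiffImage.2 ⟨_, ha i hi, _, hb j hj, rfl⟩) h1 h2 ?_⟩
  intro j hj k hk hjk
  have hbne : ∀ u v, u < v → v ≤ p → b u ≠ b v := fun u v huv hv =>
    hbmono.elim (fun h => (h u v huv hv).ne) (fun h => (h u v huv hv).ne')
  have hbjk : b j ≠ b k := (Nat.lt_or_gt_of_ne hjk).elim (fun h => hbne j k h hk.le)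
    (fun h => (hbne k j h hj.le).symm)
  have hdeg : f.derivative.natDegree = m - 1 := by rw [Polynomial.natDegree_derivative, hf]
  -- Non-vanishing is applied to f', whose degree m - 1 is at least 2; this is where m ≥ 3 enters.
  have hne : (translateDiff f (b j) (b (j + 1)) (b k) (b (k + 1))).derivative ≠ 0 := by
    rw [derivative_translateDiff]
    exact translateDiff_ne_zero (hbne j (j + 1) (by omega) hj) hbjk _ (by omega)
  have hle : (translateDiff f (b j) (b (j + 1)) (b k) (b (k + 1))).derivative.natDegree ≤ m := by
    rw [derivative_translateDiff]
    exact (natDegree_translateDiff_le _ _ _ _ _).trans (by omega)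
  -- Equality of two mixed differences in row i says that this polynomial agrees at a_i and a_{i+1}.
  refine le_trans (Finset.card_le_card ?_) ((card_filter_eval_eq_eval_succ_le hne hamono).trans hle)
  intro i hi
  obtain ⟨hi, heq⟩ := Finset.mem_filter.1 hi
  refine Finset.mem_filter.2 ⟨hi, ?_⟩
  simp only [translateDiff, Polynomial.eval_sub, Polynomial.eval_comp, Polynomial.eval_X,
    Polynomial.eval_C]
  linarith

/-! ### Exponents and conclusion. -/

theorem phi_nonneg_and_le_two : ∀ n, 0 ≤ phi n ∧ phi n ≤ 2
  | 0 => by simp [phi]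
  | 1 => by simp [phi]
  | n + 2 => by
    have h := (phi_nonneg_and_le_two (n + 1)).1
    have h0 : 0 ≤ 1 / phi (n + 1) := by positivity
    have h1 : 1 / (1 + 1 / phi (n + 1)) ≤ 1 := by
      rw [div_le_one (by linarith)]
      linarith
    rw [phi]
    exact ⟨by positivity, by linarith⟩

/-- For p = 0 the set has at most K elements and W ≥ 1 suffices; otherwise p + 1 ≤ 2p. -/
theorem mul_pow_le_of_dichotomy {N p K M k W : ℕ} (hN : N ≤ K * (p + 1))
    (hM : 1 ≤ M) (hW : 1 ≤ W) (hp : p ^ k ≤ M * W) : N ^ k ≤ (2 * K) ^ k * M * W := by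
  rcases Nat.eq_zero_or_pos p with rfl | hp0
  · calc N ^ k ≤ (2 * K) ^ k := by gcongr; omega
      _ ≤ (2 * K) ^ k * (M * W) := Nat.le_mul_of_pos_right _ (Nat.mul_pos hM hW)
      _ = _ := by ring
  · calc N ^ k ≤ (2 * K * p) ^ k := by gcongr; nlinarith
      _ = (2 * K) ^ k * p ^ k := mul_pow _ _ _
      _ ≤ (2 * K) ^ k * (M * W) := by gcongr
      _ = _ := by ring

theorem corollary1p8 (n m : ℕ) (hn : 1 ≤ n) (hm : n + 1 ≤ m) :
    ∃ C : ℝ, 0 < C ∧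
      ∀ (a b : ℝ) (A : Finset ℝ) (f : ℝ[X]),
        A.Nonempty → (A : Set ℝ) ⊆ Set.Icc a b → f.natDegree = m →
          C * (A.card : ℝ) ^ (1 + phi n) ≤
            ((iterSum (2 ^ n) (polyDiffImage f A)
              - iterSum (2 ^ n - 1) (polyDiffImage f A)).card : ℝ) := by
  suffices h : ∃ k D : ℕ, 0 < D ∧ 1 + phi n ≤ k ∧ ∀ (A : Finset ℝ) (f : ℝ[X]),
      A.Nonempty → f.natDegree = m → A.card ^ k ≤ D *
        (iterSum (2 ^ n) (polyDiffImage f A) - iterSum (2 ^ n - 1) (polyDiffImage f A)).card by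
    obtain ⟨k, D, hD, hk, h⟩ := h
    have hD' : (0 : ℝ) < D := by exact_mod_cast hD
    refine ⟨1 / D, by positivity, fun _ _ A f hA _ hf => ?_⟩
    have h1 : (1 : ℝ) ≤ A.card := by exact_mod_cast hA.card_pos
    have h2 : (A.card : ℝ) ^ (1 + phi n) ≤ (A.card : ℝ) ^ k := by
      rw [← Real.rpow_natCast]
      exact Real.rpow_le_rpow_of_exponent_le h1 hk
    have h3 : (A.card : ℝ) ^ k ≤ D * ((iterSum (2 ^ n) (polyDiffImage f A)
        - iterSum (2 ^ n - 1) (polyDiffImage f A)).card : ℝ) := by exact_mod_cast h A f hA hf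
    rw [one_div_mul_eq_div, div_le_iff₀' hD']
    exact h2.trans h3
  have hW : ∀ (A : Finset ℝ) (f : ℝ[X]), A.Nonempty → ∀ s t,
      1 ≤ (iterSum s (polyDiffImage f A) - iterSum t (polyDiffImage f A)).card :=
    fun A f hA s t => (iterSum_sub_nonempty (polyDiffImage_nonempty f hA) s t).card_pos
  rcases Nat.eq_or_lt_of_le hn with rfl | hn2
  · refine ⟨2, (2 * 2 ^ (2 * m)) ^ 2 * 2, by positivity, by norm_num [phi], fun A f hA hf => ?_⟩
    obtain ⟨p, hp, hp2⟩ := exists_sq_card_le f hm hf hA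
    exact mul_pow_le_of_dichotomy hp (by norm_num) (hW A f hA 2 1) hp2
  · refine ⟨3, (2 * 2 ^ (2 * m)) ^ 3 * (4 * (2 * m + 1) ^ 2), by positivity, ?_,
      fun A f hA hf => ?_⟩
    · have := (phi_nonneg_and_le_two n).2
      push_cast
      linarith
    · obtain ⟨p, hp, hp3⟩ := exists_cube_card_le f (by omega) hf hA
      -- The bound for 4S - 3S is padded by 2^n - 4 further summands on each side.
      refine (mul_pow_le_of_dichotomy hp (Nat.succ_le_of_lt (by positivity))
        (hW A f hA 4 3) hp3).trans (Nat.mul_le_mul_left _ (Finset.card_le_card ?_))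
      have h4 : 4 ≤ 2 ^ n := Nat.pow_le_pow_right (n := 2) (by norm_num) (Nat.succ_le_of_lt hn2)
      have := iterSum_sub_subset (polyDiffImage_nonempty f hA) 4 3 (2 ^ n - 4)
      rwa [show 4 + (2 ^ n - 4) = 2 ^ n by omega, show 3 + (2 ^ n - 4) = 2 ^ n - 1 by omega] at this
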